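/- For a finite simple graph $G$ and a graph $H$, let $ar(G,H)$ be the maximum number $k$ such that there is an edge-coloring of $G$ with exactly $k$ colors that contains no rainbow copy of $H$, where a subgraph is rainbow if all of its edges have different colors. Let $K_{n_1,\dots,n_r}$ be the complete $r$-partite graph with parts of sizes $n_1,\dots,n_r$, and let $C_3$ be the cycle of length $3$. Theorem 6. For $r\ge 3$ and $n_1\ge n_2\ge\cdots\ge n_r\ge 1$, $$ar(K_{n_1,n_2,\dots,n_r},C_3)=\begin{cases} n_1n_2+n_3n_4+\cdots+n_{r-2}n_{r-1}+n_r+\frac{r-1}{2}-1, & r \text{ is odd};\\[2pt] n_1n_2+n_3n_4+\cdots+n_{r-1}n_r+\frac r2-1, & r\text{ is even}.\end{cases}$$ -/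

import Mathlib

namespace SimpleGraph

/-- In the edge-colouring `c` of `G`, the copy `f` of `H` in `G` is rainbow:
its edges receive pairwise different colours. -/
def IsRainbowCopy {V W K : Type*} {G : SimpleGraph V} {H : SimpleGraph W}
    (c : G.EdgeLabeling K) (f : H.Copy G) : Prop :=
  Function.Injective fun e : H.edgeSet => c (f.toHom.mapEdgeSet e)

/-- There is an edge-colouring of `G` with exactly `k` colours and no rainbow copy of `H`. -/
def HasRainbowFreeColoring {V W : Type*} (G : SimpleGraph V) (H : SimpleGraph W)
    (k : ℕ) : Prop :=
  ∃ c : G.EdgeLabeling (Fin k), Function.Surjective (fun e : G.edgeSet => c e) ∧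
    ∀ f : H.Copy G, ¬ IsRainbowCopy c f

/-- `k` is the anti-Ramsey number `ar(G, H)`: the maximum number of colours in an
edge-colouring of `G` without a rainbow copy of `H`. -/
def IsAntiRamseyNumber {V W : Type*} (G : SimpleGraph V) (H : SimpleGraph W) (k : ℕ) : Prop :=
  IsGreatest {m : ℕ | HasRainbowFreeColoring G H m} k

end SimpleGraph

/-! For the upper bound, choose one edge of each colour and let `R` be the resulting graph. Its
edges have distinct colours, so every cycle of `R` is rainbow. Chords of a rainbow closed walk
repeat a colour of the triangles they form, and shortening along chords shows that the walk
alternates between two parts (`part_eq_of_rainbow_closed_walk`). Hence each block of `R` lies in two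
parts.

Peeling off end blocks one at a time bounds the edges of `R` by those of an ideal graph: parts are
grouped into pairs and singletons, each pair carries its complete bipartite graph, each singleton is
independent, and bridges join all components into a tree. Such a graph has (sum of the `pairValue`s)
- 1 edges, since `pairValue` counts edges plus components (`exists_pairingSum_of_cyclesAlternate`).
A rearrangement argument shows that the best grouping matches the parts consecutively by size
(`PairingSum.le_of_antitone`).

For the lower bound, make each consecutive pair of parts a level, and each vertex of an unmatched
last part a level of its own. Edges inside a level get private colours and other edges get their
larger level. Among three vertices not all in one level, two edges then share a colour. -/

/-- The contribution of two parts of sizes `x` and `y` matched with each other: the number of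
edges plus the number of components of the complete bipartite graph `K_{x,y}`. -/
def pairValue (x y : ℕ) : ℕ := if y = 0 then x else if x = 0 then y else x * y + 1

lemma pairValue_zero (x : ℕ) : pairValue x 0 = x := by simp [pairValue]

lemma zero_pairValue (y : ℕ) : pairValue 0 y = y := by
  unfold pairValue; split_ifs <;> omega

lemma pairValue_of_pos {x y : ℕ} (hx : 0 < x) (hy : 0 < y) : pairValue x y = x * y + 1 := by
  unfold pairValue; split_ifs <;> omega

lemma pairValue_comm (x y : ℕ) : pairValue x y = pairValue y x := by
  unfold pairValue; split_ifs <;> first | omega | (rw [mul_comm])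

lemma add_le_pairValue (x y : ℕ) : x + y ≤ pairValue x y := by
  rcases Nat.eq_zero_or_pos x with rfl | hx
  · simp [zero_pairValue]
  rcases Nat.eq_zero_or_pos y with rfl | hy
  · simp [pairValue_zero]
  rw [pairValue_of_pos hx hy]
  nlinarith

/-- Each new vertex in a part raises the value by at least one. -/
lemma pairValue_add_le (x y b : ℕ) : pairValue y x + b ≤ pairValue (y + b) x := by
  rcases Nat.eq_zero_or_pos x with rfl | hx
  · simp [pairValue_zero]
  rcases Nat.eq_zero_or_pos y with rfl | hy
  · have := add_le_pairValue b x
    simp only [zero_pairValue, zero_add]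
    omega
  rw [pairValue_of_pos hy hx, pairValue_of_pos (by omega) hx]
  nlinarith

/-- Each vertex added to a nonempty part gains an edge to every vertex of its partner. Positivity of
`x` is needed because the first vertex would merge the `z` singleton components. -/
lemma pairValue_add_mul_le {x : ℕ} (hx : 0 < x) (z a : ℕ) :
    pairValue x z + a * z ≤ pairValue (x + a) z := by
  rcases Nat.eq_zero_or_pos z with rfl | hz
  · simp [pairValue_zero]
  rw [pairValue_of_pos hx hz, pairValue_of_pos (by omega) hz]
  nlinarith

/-- Matching the two largest parts is optimal. -/
lemma pairValue_exchange {x y z t : ℕ} (hzy : z ≤ y) (htx : t ≤ x) (hx : 0 < x) (hy : 0 < y) :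
    pairValue x z + pairValue y t ≤ pairValue x y + pairValue z t := by
  rw [pairValue_of_pos hx hy]
  -- With `y = z + u` and `x = t + s`, the gain when `z` and `t` are positive is exactly `s * u`, as
  -- in the rearrangement inequality.
  obtain ⟨u, rfl⟩ := Nat.exists_eq_add_of_le hzy
  obtain ⟨s, rfl⟩ := Nat.exists_eq_add_of_le htx
  rcases Nat.eq_zero_or_pos z with rfl | hz
  · rcases Nat.eq_zero_or_pos t with rfl | ht
    · simp only [pairValue_zero, zero_add] at *
      nlinarith
    · rw [pairValue_of_pos hy ht, zero_pairValue, pairValue_zero]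
      simp only [zero_add] at *
      nlinarith
  · rw [pairValue_of_pos hx hz]
    rcases Nat.eq_zero_or_pos t with rfl | ht
    · rw [pairValue_zero, pairValue_zero]
      simp only [zero_add] at *
      nlinarith
    · rw [pairValue_of_pos hy ht, pairValue_of_pos hz ht]
      nlinarith [Nat.zero_le (s * u)]

/-- The case of an added block whose two parts are already matched with each other. -/
lemma pairValue_add_mul_le_pairValue {x y a b : ℕ} (hx : 0 < x) (hb : 0 < b) :
    pairValue x y + (a + 1) * b ≤ pairValue (x + a) (y + b) := by
  rw [pairValue_of_pos (by omega : 0 < x + a) (by omega : 0 < y + b)]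
  obtain ⟨x, rfl⟩ := Nat.exists_eq_add_of_le' hx
  obtain ⟨b, rfl⟩ := Nat.exists_eq_add_of_le' hb
  rcases Nat.eq_zero_or_pos y with rfl | hy
  · rw [pairValue_zero]
    nlinarith [Nat.zero_le (x * b)]
  · rw [pairValue_of_pos (by omega) hy]
    nlinarith [Nat.zero_le (x * b), Nat.zero_le (a * y), Nat.zero_le (x * y)]

/-- Restoring a block `K_{a+1,b}` that shares one vertex with the rest: either the present
matching or the one matching the two parts of the block gains `(a + 1) * b`. -/
lemma pairValue_block {x y a b : ℕ} (hx : 0 < x) (hb : 0 < b) (z t : ℕ) :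
    pairValue x z + pairValue y t + (a + 1) * b ≤ pairValue (x + a) z + pairValue (y + b) t ∨
    pairValue x z + pairValue y t + (a + 1) * b ≤ pairValue (x + a) (y + b) + pairValue z t := by
  -- Keeping the matching, the `a` new vertices gain `a * z ≥ a * b`, and the `b` new ones gain at
  -- least one each.
  by_cases hz : b ≤ z
  · left
    have h1 := pairValue_add_mul_le hx z a
    have h2 := pairValue_add_le t y b
    nlinarith [Nat.mul_le_mul_left a hz]
  -- Keeping the matching, the `b` new vertices gain `b * t` if `y` is positive; for `y = 0` the
  -- deficit is covered by the gain `a` on the other side.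
  by_cases ht : a + 1 ≤ t
  · left
    rcases Nat.eq_zero_or_pos a with rfl | ha
    · have h2 := pairValue_add_le t y b
      simp only [add_zero]
      omega
    have h1 := pairValue_add_le z x a
    rcases Nat.eq_zero_or_pos y with rfl | hy
    · rw [zero_pairValue, zero_add, pairValue_of_pos hb (by omega)]
      obtain ⟨s, rfl⟩ := Nat.exists_eq_add_of_le ht
      obtain ⟨b, rfl⟩ := Nat.exists_eq_add_of_le' hb
      nlinarith [Nat.zero_le (b * s)]
    · have h2 := pairValue_add_mul_le hy t b
      nlinarith [Nat.mul_le_mul_left b ht]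
  -- Both partners are now small, `z < b` and `t ≤ a`, so matching the enlarged parts wins even if
  -- `z` and `t` contribute only `z + t`.
  right
  push Not at hz ht
  have h3 := add_le_pairValue z t
  rw [pairValue_of_pos (by omega : 0 < x + a) (by omega : 0 < y + b)]
  obtain ⟨x, rfl⟩ := Nat.exists_eq_add_of_le' hx
  have e1 : pairValue (x + 1) z ≤ x * b + z + 1 := by
    rcases Nat.eq_zero_or_pos z with rfl | hz'
    · rw [pairValue_zero]; nlinarith
    · rw [pairValue_of_pos hx hz']; nlinarith [Nat.mul_le_mul_left x hz.le]
  have e2 : pairValue y t ≤ y * (a + 1) + t := by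
    rcases Nat.eq_zero_or_pos t with rfl | ht'
    · rw [pairValue_zero]; nlinarith
    rcases Nat.eq_zero_or_pos y with rfl | hy
    · rw [zero_pairValue]; omega
    · rw [pairValue_of_pos hy ht']; nlinarith [Nat.mul_le_mul_left y (Nat.lt_succ_iff.mp ht)]
  nlinarith [Nat.zero_le (x * y)]

/-! ### Pairings of a multiset of part sizes -/

/-- `PairingSum m v`: some partition of the multiset `m` into pairs and singletons has total
value `v`. -/
inductive PairingSum : Multiset ℕ → ℕ → Prop
  | nil : PairingSum 0 0
  | single (x : ℕ) {m : Multiset ℕ} {v : ℕ} : PairingSum m v →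
      PairingSum (x ::ₘ m) (pairValue x 0 + v)
  | pair (x y : ℕ) {m : Multiset ℕ} {v : ℕ} : PairingSum m v →
      PairingSum (x ::ₘ y ::ₘ m) (pairValue x y + v)

/-- The partner of an element in a pairing: nothing, counted as `0`, or one element. -/
inductive PairingSlot : ℕ → Multiset ℕ → Prop
  | empty : PairingSlot 0 0
  | part (z : ℕ) : PairingSlot z {z}

lemma PairingSlot.eq_zero {z : ℕ} {Z : Multiset ℕ} (h : PairingSlot z Z) (hZ : Z = 0) :
    z = 0 := by
  induction h with
  | empty => rfl
  | part => simp at hZ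

namespace PairingSum

lemma eq_zero {m : Multiset ℕ} {v : ℕ} (h : PairingSum m v) (hm : m = 0) : v = 0 := by
  induction h with
  | nil => rfl
  | single => simp at hm
  | pair => simp at hm

/-- Isolates the class of a chosen element. Recording a missing partner as `0` treats matched and
unmatched elements uniformly. -/
lemma exists_slot {M : Multiset ℕ} {v : ℕ} (h : PairingSum M v) :
    ∀ (x : ℕ) (m : Multiset ℕ), M = x ::ₘ m → ∃ z Z m' v', PairingSlot z Z ∧ m = Z + m' ∧
      PairingSum m' v' ∧ v = pairValue x z + v' := by
  induction h with
  | nil => intro x m h; simp at h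
  | @single y M' v' h ih =>
    intro x m hm
    rcases Multiset.cons_eq_cons.mp hm with ⟨rfl, rfl⟩ | ⟨-, cs, rfl, rfl⟩
    · exact ⟨0, 0, _, _, .empty, by simp, h, rfl⟩
    · obtain ⟨z, Z, m', v'', hZ, rfl, h', rfl⟩ := ih x cs rfl
      exact ⟨z, Z, y ::ₘ m', _, hZ, by simp, h'.single y, by omega⟩
  | @pair y t M' v' h ih =>
    intro x m hm
    rcases Multiset.cons_eq_cons.mp hm with ⟨rfl, rfl⟩ | ⟨-, cs, hcs, rfl⟩
    · exact ⟨t, {t}, _, _, .part t, by simp, h, rfl⟩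
    · rcases Multiset.cons_eq_cons.mp hcs with ⟨rfl, rfl⟩ | ⟨-, cs', rfl, rfl⟩
      · exact ⟨y, {y}, _, _, .part y, by simp, h, by rw [pairValue_comm]⟩
      · obtain ⟨z, Z, m', v'', hZ, rfl, h', rfl⟩ := ih x cs' rfl
        exact ⟨z, Z, y ::ₘ t ::ₘ m', _, hZ, by simp, h'.pair y t, by omega⟩

lemma cons_slot {m : Multiset ℕ} {v z : ℕ} {Z : Multiset ℕ} (h : PairingSum m v)
    (hZ : PairingSlot z Z) (x : ℕ) : PairingSum (x ::ₘ (Z + m)) (pairValue x z + v) := by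
  cases hZ with
  | empty => simpa using h.single x
  | part => simpa using h.pair x z

/-- Used in rematching: the partners set free are matched with each other, and empty slots cost
nothing. -/
lemma slot_slot {m : Multiset ℕ} {v z t : ℕ} {Z T : Multiset ℕ} (h : PairingSum m v)
    (hZ : PairingSlot z Z) (hT : PairingSlot t T) :
    PairingSum (Z + (T + m)) (pairValue z t + v) := by
  cases hZ with
  | part => simpa using h.cons_slot hT z
  | empty => cases hT with
    | empty => simpa [pairValue_zero] using h
    | part => simpa [pairValue_zero, zero_pairValue] using h.single t

lemma sum_self (m : Multiset ℕ) : PairingSum m m.sum := by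
  induction m using Multiset.induction_on with
  | empty => exact .nil
  | cons x m ih => simpa [pairValue_zero] using ih.single x

lemma exists_add_one {y v : ℕ} {m : Multiset ℕ} (h : PairingSum (y ::ₘ m) v) :
    ∃ v', v + 1 ≤ v' ∧ PairingSum ((y + 1) ::ₘ m) v' := by
  obtain ⟨z, Z, m', v', hZ, rfl, h', rfl⟩ := h.exists_slot y m rfl
  refine ⟨_, ?_, h'.cons_slot hZ (y + 1)⟩
  have := pairValue_add_le z y 1
  omega

/-- If the two sizes are matched, enlarge that pair. Otherwise `pairValue_block` decides whether to
keep their partners or to match the enlarged sizes and leave the partners to each other. -/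
lemma exists_add_block {x y a b v : ℕ} {m : Multiset ℕ} (h : PairingSum (x ::ₘ y ::ₘ m) v)
    (hx : 0 < x) (hb : 0 < b) :
    ∃ v', v + (a + 1) * b ≤ v' ∧ PairingSum ((x + a) ::ₘ (y + b) ::ₘ m) v' := by
  obtain ⟨z, Z, m', v', hZ, hm, h', rfl⟩ := h.exists_slot x _ rfl
  have key : (∃ v'', v' + pairValue x y + (a + 1) * b ≤ v'' ∧ z = y ∧
      PairingSum ((x + a) ::ₘ (y + b) ::ₘ m) v'') ∨ ∃ n, m' = y ::ₘ n ∧ m = Z + n := by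
    cases hZ with
    | empty => right; exact ⟨m, by simpa using hm.symm, by simp⟩
    | part =>
      rw [Multiset.singleton_add] at hm
      rcases Multiset.cons_eq_cons.mp hm with ⟨rfl, rfl⟩ | ⟨-, cs, h1, h2⟩
      · left
        have := pairValue_add_mul_le_pairValue (y := y) (a := a) hx hb
        exact ⟨_, by omega, rfl, h'.pair (x + a) (y + b)⟩
      · right; exact ⟨cs, h2, by simpa using h1⟩
  rcases key with ⟨v'', h1, rfl, h2⟩ | ⟨n, rfl, rfl⟩
  · exact ⟨v'', by omega, h2⟩
  obtain ⟨t, T, m'', w, hT, rfl, h'', rfl⟩ := h'.exists_slot y n rfl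
  rcases pairValue_block (y := y) (a := a) hx hb z t with hle | hle
  · have := (h''.cons_slot hT (y + b)).cons_slot hZ (x + a)
    rw [Multiset.add_cons] at this
    exact ⟨_, by omega, this⟩
  · exact ⟨_, by omega, (h''.slot_slot hZ hT).pair (x + a) (y + b)⟩

/-- Induction removing the two largest sizes: by `pairValue_exchange` they may be matched with each
other without loss, and the rest is again a pairing of an antitone sequence. -/
lemma le_of_antitone : ∀ (r : ℕ) (f : ℕ → ℕ) {v : ℕ}, Antitone f → (∀ i < r, 0 < f i) →
    PairingSum ((Multiset.range r).map f) v →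
    v ≤ (∑ k ∈ Finset.range (r / 2), f (2 * k) * f (2 * k + 1)) + r / 2 +
      if Odd r then f (r - 1) else 0
  | 0, f, v, _, _, h => by
    simp only [Multiset.range_zero, Multiset.map_zero] at h
    simp [h.eq_zero rfl]
  | 1, f, v, _, _, h => by
    obtain ⟨z, Z, m', v', hZ, hm, h', rfl⟩ := h.exists_slot (f 0) 0 (by simp)
    have h0 := add_eq_zero.mp hm.symm
    simp [h'.eq_zero h0.2, hZ.eq_zero h0.1, pairValue_zero]
  | r + 2, f, v, hf, hpos, h => by
    have hmap : (Multiset.range (r + 2)).map f =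
        f 0 ::ₘ f 1 ::ₘ (Multiset.range r).map fun k => f (k + 2) := by
      rw [← Multiset.coe_range, ← Multiset.coe_range, List.range_succ_eq_map,
        List.range_succ_eq_map]
      simp [Function.comp_def]
    have ih : ∀ w, PairingSum ((Multiset.range r).map fun k => f (k + 2)) w → _ := fun w hw =>
      le_of_antitone r (fun k => f (k + 2)) (fun i j hij => hf (by omega))
        (fun i hi => hpos _ (by omega)) hw
    have hmem : ∀ y ∈ (Multiset.range r).map fun k => f (k + 2), y ≤ f 1 := by
      intro y hy
      obtain ⟨k, -, rfl⟩ := Multiset.mem_map.mp hy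
      exact hf (by omega)
    have h01 : f 1 ≤ f 0 := hf (by omega)
    have hf0 := hpos 0 (by omega)
    have hf1 := hpos 1 (by omega)
    have step : ∃ w, v ≤ pairValue (f 0) (f 1) + w ∧
        PairingSum ((Multiset.range r).map fun k => f (k + 2)) w := by
      rw [hmap] at h
      generalize (Multiset.range r).map (fun k => f (k + 2)) = l at *
      obtain ⟨z, Z, m', v', hZ, hm, h', rfl⟩ := h.exists_slot (f 0) _ rfl
      have key : (z = f 1 ∧ l = m') ∨ ∃ n, m' = f 1 ::ₘ n ∧ l = Z + n := by
        cases hZ with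
        | empty => right; exact ⟨l, by simpa using hm.symm, by simp⟩
        | part =>
          rw [Multiset.singleton_add] at hm
          rcases Multiset.cons_eq_cons.mp hm with ⟨h1, h2⟩ | ⟨-, cs, h1, h2⟩
          · exact Or.inl ⟨h1.symm, h2⟩
          · right; exact ⟨cs, h2, by simpa using h1⟩
      rcases key with ⟨rfl, rfl⟩ | ⟨n, rfl, rfl⟩
      · exact ⟨v', le_rfl, h'⟩
      obtain ⟨t, T, m'', w, hT, rfl, h'', rfl⟩ := h'.exists_slot (f 1) n rfl
      refine ⟨_, ?_, h''.slot_slot hZ hT⟩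
      have hz : z ≤ f 1 := by
        cases hZ with
        | empty => omega
        | part => exact hmem z (by simp)
      have ht : t ≤ f 0 := by
        cases hT with
        | empty => omega
        | part => exact (hmem t (by simp)).trans h01
      have := pairValue_exchange hz ht hf0 hf1
      omega
    obtain ⟨w, hvw, hw⟩ := step
    have := ih w hw
    rw [pairValue_of_pos hf0 hf1] at hvw
    have hdiv : (r + 2) / 2 = r / 2 + 1 := by omega
    rw [hdiv, Finset.sum_range_succ']
    have hodd : (if Odd (r + 2) then f (r + 2 - 1) else 0) =
        if Odd r then f (r - 1 + 2) else 0 := by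
      by_cases ho : Odd r
      · have ho' : Odd (r + 2) := by
          rw [Nat.odd_iff] at *; omega
        have : r + 2 - 1 = r - 1 + 2 := by
          have := ho.pos; omega
        simp [ho, ho', this]
      · have ho' : ¬ Odd (r + 2) := by
          rw [Nat.odd_iff] at *; omega
        simp [ho, ho']
    rw [hodd]
    have hs : ∀ k, f (2 * (k + 1)) * f (2 * (k + 1) + 1) = f (2 * k + 2) * f (2 * k + 1 + 2) :=
      fun k => by congr 2
    simp only [hs, mul_zero, zero_add] at *
    omega

end PairingSum

/-! ### Rainbow closed walks -/

namespace SimpleGraph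

/-- In a multipartite graph without rainbow triangle, a closed walk with pairwise distinct
colours alternates between two parts. -/
lemma part_eq_of_rainbow_closed_walk {V ι K : Type*} {G : SimpleGraph V} {p : V → ι}
    (hp : ∀ x y, G.Adj x y ↔ p x ≠ p y) {c : Sym2 V → K}
    (hc : ∀ x y z, G.Adj x y → G.Adj y z → G.Adj x z →
      c s(x, y) = c s(y, z) ∨ c s(x, z) = c s(x, y) ∨ c s(x, z) = c s(y, z)) :
    ∀ (N : ℕ) {a b d : V} (q : G.Walk d a), q.length ≤ N → G.Adj a b → G.Adj b d →
      (c s(a, b) :: c s(b, d) :: q.edges.map c).Nodup → p a = p d := by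
  intro N
  induction N with
  | zero =>
    intro a b d q hq _ _ _
    exact congrArg p (Walk.eq_of_length_eq_zero (p := q) (by omega)).symm
  | succ N ih =>
    intro a b d q hq hab hbd hnd
    by_contra hne
    have had : G.Adj a d := (hp _ _).mpr hne
    cases q with
    | nil => exact hne rfl
    | @cons _ e _ hde q =>
      cases q with
      | nil =>
        rcases hc a b d hab hbd had with h | h | h <;> simp [h, Sym2.eq_swap (a := d)] at hnd
      | @cons _ f _ hef q =>
        -- The walk reads `a, b, d, e, …, z, a`, with `m` running from `e` to `z`.
        obtain ⟨z, m, hza, hm⟩ := Walk.exists_cons_eq_concat hef q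
        rw [hm] at hq hnd
        simp only [Walk.length_cons, Walk.length_concat] at hq
        simp only [Walk.edges_cons, Walk.edges_concat, List.concat_eq_append, List.map_cons,
          List.map_append, List.map_nil, List.nodup_cons, List.nodup_append, List.mem_cons,
          List.mem_append, List.not_mem_nil, or_false, List.nodup_nil, not_or] at hnd
        obtain ⟨⟨n1, n2, n3, n4⟩, ⟨n5, n6, n7⟩, ⟨n8, n9⟩, n10, -, n11⟩ := hnd
        have n12 : c s(z, a) ∉ m.edges.map c := fun h => n11 _ h _ rfl rfl
        have hcad : c s(a, d) = c s(a, b) ∨ c s(a, d) = c s(b, d) := by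
          rcases hc a b d hab hbd had with h | h | h
          · exact absurd h n1
          · exact Or.inl h
          · exact Or.inr h
        -- The chord `ad` reuses the colour of `ab` or `bd`, so replacing those two edges by it
        -- leaves a shorter rainbow closed walk. Induction is applied to it at `d`, then at `a`.
        have hae : p a = p e := by
          refine ih (m.concat hza) (b := d) (by simp; omega) had hde ?_
          rcases hcad with h | h <;>
          · simp only [h, Walk.edges_concat, List.concat_eq_append,
              List.map_append, List.map_cons, List.map_nil, List.nodup_cons, List.nodup_append,
              List.mem_cons, List.mem_append, List.not_mem_nil, or_false, List.nodup_nil, not_or]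
            refine ⟨⟨by assumption, by assumption, by assumption⟩, ⟨n8, n9⟩, n10, by simp, n11⟩
        have hzd : p z = p d := by
          refine ih (m.cons hde) (b := a) (by simp; omega) hza had ?_
          rcases hcad with h | h <;>
          · simp only [h, Walk.edges_cons, List.map_cons, List.nodup_cons,
              List.mem_cons, not_or]
            exact ⟨⟨Ne.symm (by assumption), Ne.symm (by assumption), n12⟩,
              ⟨by assumption, by assumption⟩, n8, n10⟩
        have hbe : G.Adj b e := (hp _ _).mpr (hae ▸ (hp _ _).mp hab.symm)
        have hcbe : c s(b, e) = c s(b, d) ∨ c s(b, e) = c s(d, e) := by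
          rcases hc b d e hbd hde hbe with h | h | h
          · exact absurd h n5
          · exact Or.inl h
          · exact Or.inr h
        -- Now shortcut `bd`, `de` by the chord `be` and apply induction at `a`. With `hzd` this
        -- puts the adjacent `b` and `d` in one part.
        have hzb : p z = p b := by
          refine ih (m.cons hbe) (b := a) (by simp; omega) hza hab ?_
          rcases hcbe with h | h <;>
          · simp only [h, Walk.edges_cons, List.map_cons, List.nodup_cons,
              List.mem_cons, not_or]
            exact ⟨⟨Ne.symm (by assumption), Ne.symm (by assumption), n12⟩,
              ⟨by assumption, by assumption⟩, by assumption, n10⟩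
        exact (hp _ _).mp hbd (hzb ▸ hzd)

/-- Two neighbours of `s` that are joined by a walk avoiding `s` lie in the same part. -/
def CyclesAlternate {V ι : Type*} (R : SimpleGraph V) (p : V → ι) : Prop :=
  ∀ s x y, R.Adj s x → R.Adj s y → (R.deleteIncidenceSet s).Reachable x y → p x = p y

/-- A path from `y` to `x` avoiding `s` closes up through `s` to a closed walk without repeated
edges, hence rainbow by injectivity. -/
lemma cyclesAlternate_of_injOn {V ι K : Type*} {G R : SimpleGraph V} {p : V → ι}
    (hp : ∀ x y, G.Adj x y ↔ p x ≠ p y) {c : Sym2 V → K}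
    (hc : ∀ x y z, G.Adj x y → G.Adj y z → G.Adj x z →
      c s(x, y) = c s(y, z) ∨ c s(x, z) = c s(x, y) ∨ c s(x, z) = c s(y, z))
    (hRG : R ≤ G) (hinj : Set.InjOn c R.edgeSet) : CyclesAlternate R p := by
  classical
  intro s x y hsx hsy hxy
  obtain ⟨q, hq⟩ := hxy.symm.exists_isPath
  have hle : R.deleteIncidenceSet s ≤ R := R.deleteIncidenceSet_le s
  by_cases hne : x = y
  · rw [hne]
  refine part_eq_of_rainbow_closed_walk hp hc _ (q.mapLe (hle.trans hRG)) le_rfl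
    (hRG hsx.symm) (hRG hsy) ?_
  have hmem : ∀ e ∈ q.edges, e ∈ R.edgeSet ∧ s ∉ e := by
    intro e he
    have := q.edges_subset_edgeSet he
    rw [edgeSet_deleteIncidenceSet] at this
    exact ⟨this.1, fun hs => this.2 ⟨this.1, hs⟩⟩
  have hnd : (s(x, s) :: s(s, y) :: q.edges).Nodup := by
    rw [List.nodup_cons, List.nodup_cons, List.mem_cons]
    refine ⟨?_, fun h => (hmem _ h).2 (by simp), hq.isTrail.edges_nodup⟩
    rintro (h | h)
    · rcases Sym2.eq_iff.mp h with h | h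
      · exact hsx.ne h.1.symm
      · exact hne h.1
    · exact (hmem _ h).2 (by simp)
  have : ((s(x, s) :: s(s, y) :: q.edges).map c).Nodup := by
    refine List.Nodup.map_on ?_ hnd
    have hall : ∀ e ∈ s(x, s) :: s(s, y) :: q.edges, e ∈ R.edgeSet := by
      intro e he
      simp only [List.mem_cons] at he
      rcases he with rfl | rfl | he
      · exact hsx.symm
      · exact hsy
      · exact (hmem e he).1
    exact fun e he e' he' h => hinj (hall e he) (hall e' he') h
  simpa using this

end SimpleGraph

/-! ### End blocks -/

namespace SimpleGraph

/-- Inside `U`, the edges leaving the nonempty set `S` all end in `w ∉ S`. -/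
structure IsEndAt {V : Type*} (R : SimpleGraph V) (U : Finset V) (w : V) (S : Finset V) :
    Prop where
  subset : S ⊆ U
  nonempty : S.Nonempty
  mem : w ∈ U
  notMem : w ∉ S
  adj : ∀ z ∈ S, ∀ u ∈ U, R.Adj z u → u ∈ S ∨ u = w

/-- Ends exist because all of `U` but one vertex is one. A minimal `S` is either a single vertex
with at most one neighbour in `U`, or an end block without its attachment vertex. -/
lemma exists_isEndAt_minimal {V : Type*} [DecidableEq V] (R : SimpleGraph V) {U : Finset V}
    (hU : 1 < U.card) : ∃ w S, R.IsEndAt U w S ∧ ∀ w' S', R.IsEndAt U w' S' →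
      S.card ≤ S'.card := by
  have hex : ∃ k w S, R.IsEndAt U w S ∧ S.card = k := by
    obtain ⟨w, hw, x, hx, hwx⟩ := Finset.one_lt_card.mp hU
    refine ⟨_, w, U.erase w, ⟨Finset.erase_subset _ _, ⟨x, by simp [hx, hwx.symm]⟩, hw, by simp,
      fun z _ u hu _ => ?_⟩, rfl⟩
    by_cases h : u = w <;> simp [h, hu]
  classical
  obtain ⟨w, S, hS, hk⟩ := Nat.find_spec hex
  exact ⟨w, S, hS, fun w' S' h => hk ▸ Nat.find_min' hex ⟨w', S', h, rfl⟩⟩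

/-- A minimal end with at least two vertices, together with its attachment vertex, lies in two
parts. -/
lemma IsEndAt.exists_two_parts {V ι : Type*} {R : SimpleGraph V} {p : V → ι}
    (hR : R.CyclesAlternate p) {U S : Finset V} {w : V} (h : R.IsEndAt U w S)
    (hmin : ∀ w' S', R.IsEndAt U w' S' → S.card ≤ S'.card) (hcard : 1 < S.card) :
    ∃ j, (∃ u ∈ S, R.Adj w u ∧ p u = j) ∧ ∀ z ∈ insert w (S : Set V), (p z = p w ∨ p z = j) ∧
      ∀ z' ∈ insert w (S : Set V), R.Adj z z' → (p z = p w ∧ p z' = j) ∨ (p z = j ∧ p z' = p w) := by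
  classical
  have hsub : ∀ w' S', R.IsEndAt U w' S' → S' ⊆ S → S' = S := fun w' S' h' hs =>
    Finset.eq_of_subset_of_card_le hs (hmin _ _ h')
  -- the neighbour of `w`
  obtain ⟨u, huS, hwu⟩ : ∃ u ∈ S, R.Adj w u := by
    by_contra! hno
    obtain ⟨s, hs⟩ := h.nonempty
    have hend : R.IsEndAt U s (S.erase s) := by
      refine ⟨(Finset.erase_subset _ _).trans h.subset, ?_, h.subset hs, by simp, ?_⟩
      · rw [← Finset.card_pos, Finset.card_erase_of_mem hs]; omega
      · intro z hz v hv hzv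
        have hzS := Finset.mem_of_mem_erase hz
        rcases h.adj z hzS v hv hzv with hvS | rfl
        · by_cases hvs : v = s <;> simp [hvs, hvS]
        · exact absurd hzv.symm (hno z hzS)
    have heq := hsub _ _ hend (Finset.erase_subset _ _)
    exact Finset.notMem_erase s S (heq.symm ▸ hs)
  -- removing a vertex does not disconnect
  have hreach : ∀ s ∈ insert w (S : Set V), ∀ x ∈ S, x ≠ s →
      (s = w → ∀ y ∈ S, (R.deleteIncidenceSet s).Reachable x y) ∧
      (s ≠ w → (R.deleteIncidenceSet s).Reachable x w) := by
    intro s hs x hx hxs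
    have hsU : s ∈ U := by
      rcases hs with rfl | hs
      · exact h.mem
      · exact h.subset hs
    by_contra hcon
    have hcon' : s = w ∨ ¬ (R.deleteIncidenceSet s).Reachable x w := by tauto
    -- The vertices of `S` reached from `x` without passing `s` form an end at `s`; by minimality
    -- they are all of `S`.
    let D := S.filter fun z => z ≠ s ∧ (R.deleteIncidenceSet s).Reachable x z
    have hD : R.IsEndAt U s D := by
      refine ⟨(Finset.filter_subset _ _).trans h.subset, ⟨x, by simp [D, hx, hxs]⟩, hsU,
        by simp [D], ?_⟩
      intro z hz v hv hzv
      obtain ⟨hzS, hzs, hxz⟩ := Finset.mem_filter.mp hz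
      by_cases hvs : v = s
      · exact Or.inr hvs
      left
      have hxv : (R.deleteIncidenceSet s).Reachable x v :=
        hxz.trans (Adj.reachable (deleteIncidenceSet_adj.mpr ⟨hzv, hzs, hvs⟩))
      refine Finset.mem_filter.mpr ⟨?_, hvs, hxv⟩
      rcases h.adj z hzS v hv hzv with hvS | rfl
      · exact hvS
      · rcases hcon' with hc | hc
        · exact absurd hc.symm hvs
        · exact absurd hxv hc
    have hDS := hsub _ _ hD (Finset.filter_subset _ _)
    apply hcon
    refine ⟨fun _ y hy => ?_, fun hsw => ?_⟩
    · rw [← hDS] at hy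
      exact (Finset.mem_filter.mp hy).2.2
    · have hsS : s ∈ S := hs.resolve_left hsw
      rw [← hDS] at hsS
      exact absurd rfl (Finset.mem_filter.mp hsS).2.1
  have hnbr : ∀ s ∈ insert w (S : Set V), ∀ x ∈ insert w (S : Set V),
      ∀ y ∈ insert w (S : Set V), R.Adj s x → R.Adj s y → p x = p y := by
    intro s hs x hx y hy hsx hsy
    by_cases hsw : s = w
    · have hxS : x ∈ S := hx.resolve_left fun e => hsx.ne (hsw.trans e.symm)
      have hyS : y ∈ S := hy.resolve_left fun e => hsy.ne (hsw.trans e.symm)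
      exact hR s x y hsx hsy ((hreach s hs x hxS hsx.ne').1 hsw y hyS)
    · have key : ∀ x ∈ insert w (S : Set V), R.Adj s x →
          (R.deleteIncidenceSet s).Reachable x w := by
        intro x hx hsx
        rcases hx with rfl | hx
        · exact Reachable.refl _
        · exact (hreach s hs x hx hsx.ne').2 hsw
      exact hR s x y hsx hsy ((key x hx hsx).trans (key y hy hsy).symm)
  -- good vertices
  let good : V → Prop := fun z =>
    (p z = p w ∧ ∀ z' ∈ insert w (S : Set V), R.Adj z z' → p z' = p u) ∨
    (p z = p u ∧ ∀ z' ∈ insert w (S : Set V), R.Adj z z' → p z' = p w)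
  have huT : u ∈ insert w (S : Set V) := Or.inr huS
  have hwT : w ∈ insert w (S : Set V) := Or.inl rfl
  have hgw : good w := Or.inl ⟨rfl, fun z' hz' hz => hnbr w hwT _ hz' _ huT hz hwu⟩
  have hgu : good u := Or.inr ⟨rfl, fun z' hz' hz => hnbr u huT _ hz' _ hwT hz hwu.symm⟩
  have hprop : ∀ z ∈ insert w (S : Set V), ∀ z' ∈ insert w (S : Set V), R.Adj z z' → good z →
      good z' := by
    rintro z hz z' hz' hzz (⟨h1, h2⟩ | ⟨h1, h2⟩)
    · exact Or.inr ⟨h2 z' hz' hzz, fun y hy hzy => (hnbr z' hz' _ hy _ hz hzy hzz.symm).trans h1⟩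
    · exact Or.inl ⟨h2 z' hz' hzz, fun y hy hzy => (hnbr z' hz' _ hy _ hz hzy hzz.symm).trans h1⟩
  have hall : ∀ z ∈ insert w (S : Set V), good z := by
    intro z hz
    by_contra hbad
    have hzS : z ∈ S := hz.resolve_left fun e => hbad (e ▸ hgw)
    -- Goodness spreads along edges, so the bad vertices form an end at `w`; it omits the good
    -- vertex `u`, against minimality.
    have hD : R.IsEndAt U w (S.filter fun z => ¬ good z) := by
      refine ⟨(Finset.filter_subset _ _).trans h.subset, ⟨z, by simp [hzS, hbad]⟩, h.mem,
        by simp [h.notMem], ?_⟩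
      intro y hy v hv hyv
      obtain ⟨hyS, hyb⟩ := Finset.mem_filter.mp hy
      rcases h.adj y hyS v hv hyv with hvS | rfl
      · exact Or.inl (Finset.mem_filter.mpr
          ⟨hvS, fun hg => hyb (hprop v (Or.inr hvS) y (Or.inr hyS) hyv.symm hg)⟩)
      · exact Or.inr rfl
    have hu' := huS
    rw [← hsub _ _ hD (Finset.filter_subset _ _)] at hu'
    exact (Finset.mem_filter.mp hu').2 hgu
  refine ⟨p u, ⟨u, huS, hwu, rfl⟩, fun z hz => ⟨?_, fun z' hz' hzz => ?_⟩⟩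
  · exact (hall z hz).imp And.left And.left
  · exact (hall z hz).imp (fun h => ⟨h.1, h.2 z' hz' hzz⟩) fun h => ⟨h.1, h.2 z' hz' hzz⟩

/-- The number of vertices of `U` in the part `i`. -/
def partCard {V ι : Type*} [DecidableEq ι] (p : V → ι) (U : Finset V) (i : ι) : ℕ :=
  (U.filter fun v => p v = i).card

/-- The ordered pairs of adjacent vertices in `U`. -/
noncomputable def adjPairs {V : Type*} (R : SimpleGraph V) (U : Finset V) : Finset (V × V) := by
  classical exact (U ×ˢ U).filter fun e => R.Adj e.1 e.2

lemma mem_adjPairs {V : Type*} {R : SimpleGraph V} {U : Finset V} {e : V × V} :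
    e ∈ R.adjPairs U ↔ (e.1 ∈ U ∧ e.2 ∈ U) ∧ R.Adj e.1 e.2 := by
  simp [adjPairs]

end SimpleGraph

/-! ### Counting edges by peeling off ends -/

lemma Finset.exists_map_univ_eq_cons {ι : Type*} [Fintype ι] [DecidableEq ι] (f g : ι → ℕ) (i : ι)
    (h : ∀ k, k ≠ i → f k = g k) : ∃ m : Multiset ℕ,
      (Finset.univ : Finset ι).val.map f = f i ::ₘ m ∧
      (Finset.univ : Finset ι).val.map g = g i ::ₘ m := by
  refine ⟨((Finset.univ : Finset ι).val.erase i).map f, ?_, ?_⟩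
  · rw [← Multiset.map_cons, Multiset.cons_erase (by simp)]
  · rw [Multiset.map_congr (f := f) (g := g) rfl, ← Multiset.map_cons, Multiset.cons_erase (by simp)]
    intro k hk
    exact h k ((Multiset.Nodup.mem_erase_iff Finset.univ.nodup).mp hk).1

lemma Finset.exists_map_univ_eq_cons_cons {ι : Type*} [Fintype ι] [DecidableEq ι] (f g : ι → ℕ)
    {i j : ι} (hij : i ≠ j) (h : ∀ k, k ≠ i → k ≠ j → f k = g k) : ∃ m : Multiset ℕ,
      (Finset.univ : Finset ι).val.map f = f i ::ₘ f j ::ₘ m ∧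
      (Finset.univ : Finset ι).val.map g = g i ::ₘ g j ::ₘ m := by
  have hu : (Finset.univ : Finset ι).val =
      i ::ₘ j ::ₘ ((Finset.univ : Finset ι).val.erase i).erase j := by
    rw [Multiset.cons_erase, Multiset.cons_erase (by simp)]
    exact (Multiset.Nodup.mem_erase_iff Finset.univ.nodup).mpr ⟨hij.symm, by simp⟩
  have hnd := (Finset.univ : Finset ι).nodup
  rw [hu] at hnd
  simp only [Multiset.nodup_cons, Multiset.mem_cons, not_or] at hnd
  refine ⟨(((Finset.univ : Finset ι).val.erase i).erase j).map f, ?_, ?_⟩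
  · conv_lhs => rw [hu]
    simp
  · conv_lhs => rw [hu]
    rw [Multiset.map_congr (f := f) (g := g) rfl]
    · simp
    · intro k hk
      exact h k (fun e => hnd.1.2 (e ▸ hk)) (fun e => hnd.2.1 (e ▸ hk))

namespace SimpleGraph

lemma IsEndAt.adjPairs_subset {V : Type*} [DecidableEq V] {R : SimpleGraph V} {U S : Finset V}
    {w : V} (h : R.IsEndAt U w S) :
    R.adjPairs U ⊆ R.adjPairs (U \ S) ∪ R.adjPairs (insert w S) := by
  rintro ⟨x, y⟩ he
  simp only [mem_adjPairs, Finset.mem_union, Finset.mem_sdiff, Finset.mem_insert] at he ⊢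
  obtain ⟨⟨hx, hy⟩, hxy⟩ := he
  by_cases hxS : x ∈ S
  · have := h.adj x hxS y hy hxy
    tauto
  · by_cases hyS : y ∈ S
    · have := h.adj y hyS x hx hxy.symm
      tauto
    · tauto

/-- A multipartite graph whose cycles alternate between two parts has at most as many edges as a
disjoint union of complete bipartite graphs on pairs of parts, joined by bridges. -/
theorem exists_pairingSum_of_cyclesAlternate {V ι : Type*} [Fintype ι] [DecidableEq ι]
    {R : SimpleGraph V} {p : V → ι} (hp : ∀ x y, R.Adj x y → p x ≠ p y)
    (hR : R.CyclesAlternate p) : ∀ (N : ℕ) (U : Finset V), U.card ≤ N → U.Nonempty →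
      ∃ v, (R.adjPairs U).card + 2 ≤ 2 * v ∧
        PairingSum ((Finset.univ : Finset ι).val.map (partCard p U)) v := by
  classical
  intro N
  induction N with
  | zero =>
    intro U hN hU
    have := hU.card_pos
    omega
  | succ N ih =>
    intro U hN hU
    have hsplit : ∀ S ⊆ U, ∀ i, partCard p U i = partCard p (U \ S) i + partCard p S i := by
      intro S hS i
      unfold partCard
      rw [← Finset.card_union_of_disjoint, ← Finset.filter_union, Finset.sdiff_union_of_subset hS]
      exact Finset.disjoint_filter_filter Finset.sdiff_disjoint
    by_cases hcard : U.card = 1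
    · refine ⟨_, ?_, PairingSum.sum_self _⟩
      obtain ⟨x, rfl⟩ := Finset.card_eq_one.mp hcard
      have h0 : R.adjPairs {x} = ∅ := by
        ext ⟨a, b⟩
        simp only [mem_adjPairs, Finset.mem_singleton, Finset.notMem_empty, iff_false]
        rintro ⟨⟨rfl, rfl⟩, h⟩
        exact h.ne rfl
      have h1 : ((Finset.univ : Finset ι).val.map (partCard p {x})).sum = 1 := by
        change ∑ i, partCard p {x} i = 1
        simp only [partCard]
        rw [← Finset.card_eq_sum_card_fiberwise (f := p) (by simp), Finset.card_singleton]
      rw [h0, h1]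
      simp
    have hU1 : 1 < U.card := by
      have := hU.card_pos
      omega
    obtain ⟨w, S, hS, hmin⟩ := R.exists_isEndAt_minimal hU1
    have hcS := hS.nonempty.card_pos
    have hwU : w ∈ U \ S := Finset.mem_sdiff.mpr ⟨hS.mem, hS.notMem⟩
    have hcU : (U \ S).card + S.card = U.card := Finset.card_sdiff_add_card_eq_card hS.subset
    -- The attachment vertex `w` stays in `U \ S`. Since `adjPairs` counts each edge twice, the
    -- inductive bound says that edges plus one is at most `v`.
    obtain ⟨v, hv, hP⟩ := ih (U \ S) (by omega) ⟨w, hwU⟩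
    have hpairs : (R.adjPairs U).card ≤
        (R.adjPairs (U \ S)).card + (R.adjPairs (insert w S)).card :=
      (Finset.card_le_card hS.adjPairs_subset).trans (Finset.card_union_le _ _)
    by_cases hS1 : S.card = 1
    · obtain ⟨s, rfl⟩ := Finset.card_eq_one.mp hS1
      have h2 : (R.adjPairs {w, s}).card ≤ 2 := by
        have : R.adjPairs {w, s} ⊆ {(w, s), (s, w)} := by
          rintro ⟨x, y⟩ he
          simp only [mem_adjPairs, Finset.mem_insert, Finset.mem_singleton, Prod.mk.injEq] at he ⊢
          obtain ⟨⟨rfl | rfl, rfl | rfl⟩, h⟩ := he <;> simp_all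
        exact (Finset.card_le_card this).trans Finset.card_le_two
      obtain ⟨m, hm1, hm2⟩ := Finset.exists_map_univ_eq_cons (partCard p (U \ {s}))
        (partCard p U) (p s) (by
          intro k hk
          rw [hsplit _ hS.subset k]
          simp [partCard, Finset.filter_singleton, hk.symm])
      rw [hm1] at hP
      obtain ⟨v', hv', hP'⟩ := hP.exists_add_one
      refine ⟨v', by omega, ?_⟩
      rw [hm2, hsplit _ hS.subset]
      simpa [partCard, Finset.filter_singleton] using hP'
    obtain ⟨j, ⟨u, huS, hwu, huj⟩, hT⟩ := hS.exists_two_parts hR hmin (by omega)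
    have hS' : ∀ z ∈ S, z ∈ insert w (S : Set V) := fun z hz => Or.inr hz
    have hjw : p w ≠ j := huj ▸ hp w u hwu
    -- The block is bipartite between two parts; the `+ 1` is `w`, which belongs to the block but
    -- not to `S`.
    have hblock : (R.adjPairs (insert w S)).card ≤
        2 * ((partCard p S (p w) + 1) * partCard p S j) := by
      have hsub : R.adjPairs (insert w S) ⊆
          (insert w (S.filter fun z => p z = p w) ×ˢ S.filter fun z => p z = j) ∪
          ((S.filter fun z => p z = j) ×ˢ insert w (S.filter fun z => p z = p w)) := by
        rintro ⟨x, y⟩ he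
        simp only [mem_adjPairs, Finset.mem_insert] at he
        obtain ⟨⟨hx, hy⟩, hxy⟩ := he
        simp only [Finset.mem_union, Finset.mem_product, Finset.mem_insert, Finset.mem_filter]
        have hne : ∀ z, p z = j → z ≠ w := fun z hz e => hjw (e ▸ hz)
        rcases (hT x hx).2 y hy hxy with ⟨h1, h2⟩ | ⟨h1, h2⟩
        · exact Or.inl ⟨hx.imp id fun h => ⟨h, h1⟩, hy.resolve_left (hne y h2), h2⟩
        · exact Or.inr ⟨⟨hx.resolve_left (hne x h1), h1⟩, hy.imp id fun h => ⟨h, h2⟩⟩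
      refine (Finset.card_le_card hsub).trans ((Finset.card_union_le _ _).trans ?_)
      rw [Finset.card_product, Finset.card_product, Finset.card_insert_of_notMem
        (by simp [hS.notMem])]
      unfold partCard
      exact le_of_eq (by ring)
    obtain ⟨m, hm1, hm2⟩ := Finset.exists_map_univ_eq_cons_cons (partCard p (U \ S))
      (partCard p U) hjw (by
        intro k hk1 hk2
        rw [hsplit _ hS.subset k]
        have : partCard p S k = 0 := by
          rw [partCard, Finset.card_eq_zero, Finset.filter_eq_empty_iff]
          intro z hz hzk
          rcases (hT z (hS' z hz)).1 with h | h
          · exact hk1 (hzk ▸ h)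
          · exact hk2 (hzk ▸ h)
        omega)
    rw [hm1] at hP
    obtain ⟨v', hv', hP'⟩ := hP.exists_add_block (a := partCard p S (p w))
      (b := partCard p S j) (Finset.card_pos.mpr ⟨w, by simp [hS.mem, hS.notMem]⟩)
      (Finset.card_pos.mpr ⟨u, by simp [huS, huj]⟩)
    refine ⟨v', by omega, ?_⟩
    rwa [hm2, hsplit _ hS.subset, hsplit _ hS.subset]

end SimpleGraph

/-! ### From colourings to pairings -/

namespace SimpleGraph

/-- A colouring has no rainbow copy of `C₃` iff in every triangle two edges share a colour. -/
lemma forall_not_isRainbowCopy_cycleGraph_three_iff {V K : Type*} {G : SimpleGraph V}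
    (c : G.EdgeLabeling K) :
    (∀ f : (cycleGraph 3).Copy G, ¬ IsRainbowCopy c f) ↔
      ∀ x y z (hxy : G.Adj x y) (hyz : G.Adj y z) (hxz : G.Adj x z),
        c ⟨s(x, y), hxy⟩ = c ⟨s(y, z), hyz⟩ ∨ c ⟨s(x, z), hxz⟩ = c ⟨s(x, y), hxy⟩ ∨
          c ⟨s(x, z), hxz⟩ = c ⟨s(y, z), hyz⟩ := by
  constructor
  · intro h x y z hxy hyz hxz
    by_contra! hcon
    obtain ⟨h1, h2, h3⟩ := hcon
    let φ : cycleGraph 3 →g G :=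
      { toFun := ![x, y, z]
        map_rel' := by
          intro a b hab
          rw [cycleGraph_three_eq_top, top_adj] at hab
          fin_cases a <;> fin_cases b <;>
            first
            | exact absurd rfl hab
            | exact hxy
            | exact hyz
            | exact hxz
            | exact hxy.symm
            | exact hyz.symm
            | exact hxz.symm }
    have hφ : Function.Injective φ := by
      have e1 := hxy.ne
      have e2 := hyz.ne
      have e3 := hxz.ne
      intro a b hab
      have hab' : ![x, y, z] a = ![x, y, z] b := hab
      fin_cases a <;> fin_cases b <;> simp_all
    have hedge : ∀ e ∈ (cycleGraph 3).edgeSet, e = s(0, 1) ∨ e = s(1, 2) ∨ e = s(0, 2) := by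
      intro e
      induction e with
      | h a b =>
        rw [cycleGraph_three_eq_top, mem_edgeSet, top_adj]
        revert a b
        decide
    refine h ⟨φ, hφ⟩ ?_
    have v1 : ∀ he, c (φ.mapEdgeSet ⟨s(0, 1), he⟩) = c ⟨s(x, y), hxy⟩ := fun _ => rfl
    have v2 : ∀ he, c (φ.mapEdgeSet ⟨s(1, 2), he⟩) = c ⟨s(y, z), hyz⟩ := fun _ => rfl
    have v3 : ∀ he, c (φ.mapEdgeSet ⟨s(0, 2), he⟩) = c ⟨s(x, z), hxz⟩ := fun _ => rfl
    rintro ⟨e, he⟩ ⟨e', he'⟩ hee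
    have hee' : c (φ.mapEdgeSet ⟨e, he⟩) = c (φ.mapEdgeSet ⟨e', he'⟩) := hee
    rcases hedge e he with rfl | rfl | rfl <;> rcases hedge e' he' with rfl | rfl | rfl <;>
      first
      | rfl
      | (exfalso
         simp only [v1, v2, v3] at hee'
         first
         | exact h1 hee'
         | exact h2 hee'
         | exact h3 hee'
         | exact h1 hee'.symm
         | exact h2 hee'.symm
         | exact h3 hee'.symm)
  · intro h f hf
    have adj : ∀ a b : Fin 3, a ≠ b → (cycleGraph 3).Adj a b := by
      intro a b hab
      rwa [cycleGraph_three_eq_top, top_adj]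
    have a01 := adj 0 1 (by decide)
    have a12 := adj 1 2 (by decide)
    have a02 := adj 0 2 (by decide)
    have key : ∀ e e' : (cycleGraph 3).edgeSet, c (f.toHom.mapEdgeSet e) =
        c (f.toHom.mapEdgeSet e') → e.1 = e'.1 := fun e e' he => congrArg Subtype.val (hf he)
    rcases h (f 0) (f 1) (f 2) (f.toHom.map_rel a01) (f.toHom.map_rel a12)
      (f.toHom.map_rel a02) with h | h | h
    · exact absurd (key ⟨s(0, 1), a01⟩ ⟨s(1, 2), a12⟩ h)
        (by decide : (s(0, 1) : Sym2 (Fin 3)) ≠ s(1, 2))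
    · exact absurd (key ⟨s(0, 2), a02⟩ ⟨s(0, 1), a01⟩ h)
        (by decide : (s(0, 2) : Sym2 (Fin 3)) ≠ s(0, 1))
    · exact absurd (key ⟨s(0, 2), a02⟩ ⟨s(1, 2), a12⟩ h)
        (by decide : (s(0, 2) : Sym2 (Fin 3)) ≠ s(1, 2))

/-- The number of colours of a colouring of a complete multipartite graph without rainbow
triangle is bounded by the value of some pairing of the part sizes. -/
theorem HasRainbowFreeColoring.exists_pairingSum {V ι : Type*} [Fintype V] [Nonempty V]
    [Fintype ι] [DecidableEq ι] {G : SimpleGraph V} {p : V → ι}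
    (hp : ∀ x y, G.Adj x y ↔ p x ≠ p y) {m : ℕ}
    (h : HasRainbowFreeColoring G (cycleGraph 3) m) :
    ∃ v, m + 1 ≤ v ∧
      PairingSum ((Finset.univ : Finset ι).val.map (partCard p Finset.univ)) v := by
  classical
  obtain ⟨c, hsurj, hrb⟩ := h
  rw [forall_not_isRainbowCopy_cycleGraph_three_iff] at hrb
  let C : Sym2 V → Option (Fin m) := fun e => if h : e ∈ G.edgeSet then some (c ⟨e, h⟩) else none
  have hC : ∀ x y (h : G.Adj x y), C s(x, y) = some (c ⟨s(x, y), h⟩) := fun x y h => dif_pos h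
  have hex : ∀ k : Fin m, ∃ x y, G.Adj x y ∧ C s(x, y) = some k := by
    intro k
    obtain ⟨⟨e, he⟩, hk⟩ := hsurj k
    induction e with
    | h x y => exact ⟨x, y, he, by rw [hC x y he]; exact congrArg some hk⟩
  choose x y hxy hk using hex
  let R : SimpleGraph V := fromEdgeSet (Set.range fun k => s(x k, y k))
  have hRe : ∀ e ∈ R.edgeSet, ∃ k, s(x k, y k) = e := by
    intro e he
    rw [edgeSet_fromEdgeSet] at he
    exact he.1
  have hRG : R ≤ G := by
    intro a b hab
    obtain ⟨k, hk'⟩ := hRe s(a, b) hab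
    exact (G.mem_edgeSet).mp (hk' ▸ hxy k)
  have hRadj : ∀ k, R.Adj (x k) (y k) := fun k =>
    (fromEdgeSet_adj _).mpr ⟨⟨k, rfl⟩, (hxy k).ne⟩
  have halt : R.CyclesAlternate p := by
    refine cyclesAlternate_of_injOn hp (c := C) ?_ hRG ?_
    · intro a b d hab hbd had
      rw [hC _ _ hab, hC _ _ hbd, hC _ _ had, Option.some_inj, Option.some_inj, Option.some_inj]
      exact hrb a b d hab hbd had
    · intro e he e' he' hee
      obtain ⟨k, rfl⟩ := hRe e he
      obtain ⟨k', rfl⟩ := hRe e' he'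
      simp only [hk, Option.some_inj] at hee
      rw [hee]
  obtain ⟨v, hv, hP⟩ := exists_pairingSum_of_cyclesAlternate
    (fun a b hab => (hp a b).mp (hRG hab)) halt _ Finset.univ le_rfl Finset.univ_nonempty
  refine ⟨v, ?_, hP⟩
  -- Both orientations of each representative edge, to match the ordered pairs in `adjPairs`.
  let g : Fin m × Bool → V × V := fun q => if q.2 then (x q.1, y q.1) else (y q.1, x q.1)
  have hgs : ∀ q, s((g q).1, (g q).2) = s(x q.1, y q.1) := by
    rintro ⟨k, _ | _⟩
    · exact Sym2.eq_swap
    · rfl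
  have hg : Function.Injective g := by
    intro q q' hqq
    have h1 : q.1 = q'.1 := by
      have := (hk q.1).symm.trans ((congrArg C ((hgs q).symm.trans
        ((congrArg (fun w : V × V => s(w.1, w.2)) hqq).trans (hgs q')))).trans (hk q'.1))
      exact Option.some_inj.mp this
    obtain ⟨k, b⟩ := q
    obtain ⟨k', b'⟩ := q'
    obtain rfl : k = k' := h1
    have hne := (hxy k).ne
    cases b <;> cases b' <;> simp_all [g]
  have hle : (Finset.univ : Finset (Fin m × Bool)).card ≤ (R.adjPairs Finset.univ).card := by
    refine Finset.card_le_card_of_injOn g ?_ hg.injOn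
    intro q _
    refine mem_adjPairs.mpr ⟨by simp, ?_⟩
    rw [← mem_edgeSet, hgs]
    exact hRadj q.1
  simp only [Finset.card_univ, Fintype.card_prod, Fintype.card_fin, Fintype.card_bool] at hle
  omega

/-! ### The extremal colouring and the final count -/

/-- The colouring in which an edge inside a level keeps its own colour, and an edge between two
levels is coloured by the larger one. -/
def levelColor {V : Type*} (l : V → ℕ) : Sym2 V → Sym2 V ⊕ ℕ :=
  Sym2.lift ⟨fun x y => if l x = l y then .inl s(x, y) else .inr (max (l x) (l y)), by
    intro x y
    simp only [eq_comm (a := l x), Sym2.eq_swap (a := x), max_comm (l x)]⟩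

lemma levelColor_mk {V : Type*} (l : V → ℕ) (x y : V) :
    levelColor l s(x, y) = if l x = l y then .inl s(x, y) else .inr (max (l x) (l y)) := rfl

/-- If two vertices of a triangle share a level, their edges to the third agree; if all levels
differ, the two edges at the highest vertex agree. The colours used are renumbered by `Fin m`, and
`g` exhibits enough distinct ones. -/
lemma exists_le_hasRainbowFreeColoring {V A : Type*} [Finite V] [Fintype A] (G : SimpleGraph V)
    (l : V → ℕ) (hl : ∀ x y z, G.Adj x y → G.Adj y z → G.Adj x z → l x = l y → l y ≠ l z)
    (g : A → Sym2 V) (hgG : ∀ a, g a ∈ G.edgeSet)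
    (hg : Function.Injective fun a => levelColor l (g a)) :
    ∃ m, Fintype.card A ≤ m ∧ HasRainbowFreeColoring G (cycleGraph 3) m := by
  classical
  let C : G.edgeSet → Set.range fun e : G.edgeSet => levelColor l e.1 := fun e => ⟨_, e, rfl⟩
  have : Finite (Set.range fun e : G.edgeSet => levelColor l e.1) := Set.finite_range _
  let E := Finite.equivFin (Set.range fun e : G.edgeSet => levelColor l e.1)
  refine ⟨Nat.card (Set.range fun e : G.edgeSet => levelColor l e.1), ?_, fun e => E (C e), ?_, ?_⟩
  · rw [← Nat.card_eq_fintype_card]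
    refine Nat.card_le_card_of_injective (fun a => C ⟨g a, hgG a⟩) fun a b hab => hg ?_
    exact congrArg Subtype.val hab
  · refine E.surjective.comp ?_
    rintro ⟨_, e, rfl⟩
    exact ⟨e, rfl⟩
  · refine (forall_not_isRainbowCopy_cycleGraph_three_iff _).mpr ?_
    intro x y z hxy hyz hxz
    have h := hl x y z hxy hyz hxz
    simp only [E.injective.eq_iff, C, Subtype.mk.injEq, levelColor_mk]
    by_cases h1 : l x = l y
    · have h2 := h h1
      have h3 : l x ≠ l z := h1 ▸ h2
      right; right
      rw [if_neg h2, if_neg h3, h1]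
    by_cases h2 : l y = l z
    · right; left
      rw [if_neg h1, if_neg (h2 ▸ h1), h2]
    by_cases h3 : l x = l z
    · left
      rw [if_neg h1, if_neg h2, h3, max_comm]
    rw [if_neg h1, if_neg h2, if_neg h3]
    simp only [Sum.inr.injEq]
    omega

end SimpleGraph

namespace SimpleGraph

/-- The levels of the extremal colouring: two consecutive parts form one level, and each vertex of
an unmatched last part is a level of its own. -/
def pairLevel {r : ℕ} {n : Fin r → ℕ} (x : Σ i, Fin (n i)) : ℕ :=
  if x.1.val / 2 < r / 2 then x.1.val / 2 else r / 2 + x.2.val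

/-- The anti-Ramsey number of the triangle in a complete multipartite graph, for either parity of
the number of parts. -/
theorem isAntiRamseyNumber_completeMultipartiteGraph {r : ℕ} (hr : 3 ≤ r) {n : Fin r → ℕ}
    (N : ℕ → ℕ) (hN : Antitone N) (hNn : ∀ i : Fin r, n i = N i) (hpos : ∀ i, 1 ≤ n i) :
    IsAntiRamseyNumber (completeMultipartiteGraph fun i : Fin r => Fin (n i)) (cycleGraph 3)
      ((∑ k ∈ Finset.range (r / 2), N (2 * k) * N (2 * k + 1)) + r / 2 +
        (if Odd r then N (r - 1) else 0) - 1) := by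
  obtain rfl : n = fun i : Fin r => N i := funext hNn
  have hpos' : ∀ i < r, 0 < N i := fun i hi => hpos ⟨i, hi⟩
  have hadj : ∀ x y : Σ i : Fin r, Fin (N i),
      (completeMultipartiteGraph fun i : Fin r => Fin (N i)).Adj x y ↔ x.1 ≠ y.1 :=
    fun x y => Iff.rfl
  have upper : ∀ m, HasRainbowFreeColoring (completeMultipartiteGraph fun i : Fin r => Fin (N i))
      (cycleGraph 3) m → m ≤ (∑ k ∈ Finset.range (r / 2), N (2 * k) * N (2 * k + 1)) + r / 2 +
        (if Odd r then N (r - 1) else 0) - 1 := by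
    intro m hm
    have : Nonempty (Σ i : Fin r, Fin (N i)) :=
      ⟨⟨⟨0, by omega⟩, ⟨0, hpos' 0 (by omega)⟩⟩⟩
    obtain ⟨v, hv, hP⟩ := hm.exists_pairingSum (p := Sigma.fst) hadj
    have hcard : partCard (Sigma.fst : (Σ i : Fin r, Fin (N i)) → Fin r) Finset.univ =
        fun i : Fin r => N i := by
      funext i
      have : (Finset.univ.filter fun x : Σ i : Fin r, Fin (N i) => x.1 = i) =
          Finset.univ.map (Function.Embedding.sigmaMk i) := by
        ext ⟨j, t⟩
        simp only [Finset.mem_filter, Finset.mem_univ, true_and, Finset.mem_map,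
          Function.Embedding.sigmaMk_apply]
        constructor
        · rintro rfl
          exact ⟨t, rfl⟩
        · rintro ⟨t', h⟩
          exact (congrArg Sigma.fst h).symm
      rw [partCard, this, Finset.card_map, Finset.card_univ, Fintype.card_fin]
    have hmap : (Finset.univ : Finset (Fin r)).val.map (fun i : Fin r => N i) =
        (Multiset.range r).map N := by
      rw [Fin.univ_val_map, ← Multiset.coe_range, Multiset.map_coe]
      congr 1
      exact List.ext_getElem (by simp) (by simp)
    rw [hcard, hmap] at hP
    have := hP.le_of_antitone r N hN hpos'
    omega
  -- Every positive level has a vertex outside part `0`, hence adjacent to the vertex `o` of level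
  -- `0`; that edge has colour `t`. This yields the number of levels minus one as cross colours.
  have hlevel : ∀ t, 0 < t → t < r / 2 + (if Odd r then N (r - 1) else 0) →
      ∃ x : Σ i : Fin r, Fin (N i), 2 ≤ x.1.val ∧ pairLevel x = t := by
    intro t ht htL
    by_cases h : t < r / 2
    · refine ⟨⟨⟨2 * t, by omega⟩, ⟨0, hpos' _ (by omega)⟩⟩, by simp; omega, ?_⟩
      simp [pairLevel, h]
    · by_cases ho : Odd r
      · rw [if_pos ho] at htL
        rw [Nat.odd_iff] at ho
        refine ⟨⟨⟨r - 1, by omega⟩, ⟨t - r / 2, by simp; omega⟩⟩, by simp; omega, ?_⟩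
        have : ¬ (r - 1) / 2 < r / 2 := by omega
        simp only [pairLevel, this, if_false]
        omega
      · rw [if_neg ho] at htL
        omega
  have hlevel' : ∀ t : Fin (r / 2 + (if Odd r then N (r - 1) else 0) - 1),
      ∃ x : Σ i : Fin r, Fin (N i), 2 ≤ x.1.val ∧ pairLevel x = t.val + 1 :=
    fun t => hlevel _ (by omega) (by omega)
  choose w hw2 hwl using hlevel'
  let o : Σ i : Fin r, Fin (N i) := ⟨⟨0, by omega⟩, ⟨0, hpos' 0 (by omega)⟩⟩
  have ho : pairLevel o = 0 := by
    have : 0 < r / 2 := by omega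
    simp [pairLevel, o, this]
  let left : (Σ j : Fin (r / 2), Fin (N (2 * j)) × Fin (N (2 * j + 1))) →
      Σ i : Fin r, Fin (N i) := fun q => ⟨⟨2 * q.1, by omega⟩, q.2.1⟩
  let right : (Σ j : Fin (r / 2), Fin (N (2 * j)) × Fin (N (2 * j + 1))) →
      Σ i : Fin r, Fin (N i) := fun q => ⟨⟨2 * q.1 + 1, by omega⟩, q.2.2⟩
  have hleft : ∀ q, pairLevel (left q) = q.1.val := by
    intro q
    have := q.1.isLt
    simp [pairLevel, left]
  have hright : ∀ q, pairLevel (right q) = q.1.val := by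
    intro q
    have h1 : (2 * q.1.val + 1) / 2 = q.1.val := by omega
    simp [pairLevel, right, h1]
  let g : (Σ j : Fin (r / 2), Fin (N (2 * j)) × Fin (N (2 * j + 1))) ⊕
      Fin (r / 2 + (if Odd r then N (r - 1) else 0) - 1) → Sym2 (Σ i : Fin r, Fin (N i)) :=
    Sum.elim (fun q => s(left q, right q)) fun t => s(o, w t)
  have hgl : ∀ q, levelColor pairLevel (g (.inl q)) = .inl s(left q, right q) := by
    intro q
    simp only [g, Sum.elim_inl, levelColor_mk, hleft, hright, if_true]
  have hgr : ∀ t, levelColor pairLevel (g (.inr t)) = .inr (t.val + 1) := by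
    intro t
    simp only [g, Sum.elim_inr, levelColor_mk, ho, hwl]
    simp
  obtain ⟨m, hm, hcol⟩ := exists_le_hasRainbowFreeColoring
    (completeMultipartiteGraph fun i : Fin r => Fin (N i)) pairLevel
    (by
      rintro ⟨x, a⟩ ⟨y, b⟩ ⟨z, d⟩ hxy hyz hxz h1 h2
      rw [hadj, ne_eq, Fin.ext_iff] at hxy hyz hxz
      dsimp only at hxy hyz hxz
      simp only [pairLevel] at h1 h2
      split_ifs at h1 h2 <;> omega) g
    (by
      rintro (q | t)
      · refine (hadj _ _).mpr fun h => ?_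
        have := congrArg Fin.val h
        simp [left, right] at this
      · refine (hadj _ _).mpr fun h => ?_
        have := congrArg Fin.val h
        have h2 := hw2 t
        simp only [o] at this
        omega)
    (by
      rintro (q | t) (q' | t') h
      · simp only [hgl, Sum.inl.injEq, Sym2.eq_iff] at h
        rcases h with ⟨h1, h2⟩ | ⟨h1, h2⟩
        · obtain ⟨j, a, b⟩ := q
          obtain ⟨j', a', b'⟩ := q'
          obtain rfl : j = j' := by
            have := congrArg (fun x : Σ i : Fin r, Fin (N i) => x.1.val) h1
            simp only [left] at this
            exact Fin.ext (by omega)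
          simp only [left, right, Sigma.mk.injEq, heq_eq_eq, true_and] at h1 h2
          rw [h1, h2]
        · have := congrArg (fun x : Σ i : Fin r, Fin (N i) => x.1.val) h1
          simp only [left, right] at this
          omega
      · simp only [hgl, hgr] at h
        cases h
      · simp only [hgl, hgr] at h
        cases h
      · simp only [hgr, Sum.inr.injEq] at h
        rw [Fin.ext (by omega : t.val = t'.val)])
  have hcardA : Fintype.card ((Σ j : Fin (r / 2), Fin (N (2 * j)) × Fin (N (2 * j + 1))) ⊕
      Fin (r / 2 + (if Odd r then N (r - 1) else 0) - 1)) =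
      (∑ k ∈ Finset.range (r / 2), N (2 * k) * N (2 * k + 1)) + r / 2 +
        (if Odd r then N (r - 1) else 0) - 1 := by
    rw [Fintype.card_sum, Fintype.card_sigma, Fintype.card_fin, Finset.sum_range]
    simp only [Fintype.card_prod, Fintype.card_fin]
    omega
  rw [hcardA] at hm
  -- The construction is only known to use at least the required number of colours; the upper bound
  -- forces equality.
  exact ⟨le_antisymm (upper m hcol) hm ▸ hcol, upper⟩

end SimpleGraph

theorem theorem6 (r : ℕ) (hr : 3 ≤ r) (n : Fin r → ℕ) (hn : Antitone n)
    (hpos : ∀ i, 1 ≤ n i) :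
    (Odd r →
      SimpleGraph.IsAntiRamseyNumber
        (SimpleGraph.completeMultipartiteGraph fun i : Fin r => Fin (n i))
        (SimpleGraph.cycleGraph 3)
        ((∑ j : Fin ((r - 1) / 2), n ⟨2 * j, by omega⟩ * n ⟨2 * j + 1, by omega⟩) +
          n ⟨r - 1, by omega⟩ + (r - 1) / 2 - 1)) ∧
    (Even r →
      SimpleGraph.IsAntiRamseyNumber
        (SimpleGraph.completeMultipartiteGraph fun i : Fin r => Fin (n i))
        (SimpleGraph.cycleGraph 3)
        ((∑ j : Fin (r / 2), n ⟨2 * j, by omega⟩ * n ⟨2 * j + 1, by omega⟩) +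
          r / 2 - 1)) := by
  -- Extension by zero beyond `r` keeps the sequence antitone, and positivity is only required below
  -- `r`.
  let N : ℕ → ℕ := fun i => if h : i < r then n ⟨i, h⟩ else 0
  have hNval : ∀ i (h : i < r), N i = n ⟨i, h⟩ := fun i h => dif_pos h
  have hN : Antitone N := by
    intro i j hij
    by_cases hj : j < r
    · rw [hNval j hj, hNval i (by omega)]
      exact hn hij
    · simp [N, hj]
  have key := SimpleGraph.isAntiRamseyNumber_completeMultipartiteGraph hr N hN
    (fun i => (hNval i i.isLt).symm) hpos
  constructor
  · intro ho
    have hdiv : r / 2 = (r - 1) / 2 := by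
      rw [Nat.odd_iff] at ho; omega
    rw [if_pos ho, hdiv, Finset.sum_range, hNval (r - 1) (by omega), add_right_comm] at key
    convert key using 5 with j
    exact (congrArg₂ (· * ·) (hNval _ _) (hNval _ _)).symm
  · intro he
    rw [if_neg (Nat.not_odd_iff_even.mpr he), Finset.sum_range, add_zero] at key
    convert key using 4 with j
    exact (congrArg₂ (· * ·) (hNval _ _) (hNval _ _)).symm
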